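/- Let $X$ be a non-empty compact metric space with metric $d$ and let $T:X\to X$ be continuous. Let $M(X)$ be the space of Borel probability measures on $X$ with the weak-* topology (a compact metrizable space), let $T_M:M(X)\to M(X)$, $T_M\mu=\mu\circ T^{-1}$, and let $M(X,T)=\{\mu\in M(X): T_M\mu=\mu\}$. A continuous self-map $S$ of a compact metric space $(Y,\rho)$ is called proximal if $\liminf_{n\to\infty}\rho(S^nu,S^nv)=0$ for all $u,v\in Y$. Then the following conditions are equivalent: 1. $(X,T)$ is strongly proximal, that is, $(M(X),T_M)$ is proximal (with respect to a metric inducing the weak-* topology, for instance the Lévy–Prokhorov metric; the choice does not matter). 2. $(X,T)$ is proximal and uniquely ergodic, that is, $(X,T)$ is proximal and $M(X,T)$ is a singleton. 3. $\operatorname{supp}(X,T)$ is a singleton, where $\operatorname{supp}(X,T)$ is the smallest closed set $C\subset X$ with $\mu(C)=1$ for all $\mu\in M(X,T)$. 4. $BP(X,T)=X^2$, that is, every pair $(x,y)\in X^2$ is Banach proximal: for every $\varepsilon>0$ the set $F=\{n\ge 0: d(T^nx,T^ny)<\varepsilon\}$ has Banach density one, meaning that for every $\lambda<1$ there is $N\ge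 1$ such that $\#(F\cap I)\ge\lambda\,\#(I)$ for every finite interval $I$ of non-negative integers with $\#(I)\ge N$. 5. For every pair $(x,y)\in X^2$ and every $\varepsilon>0$, the set $F=\{n\ge 0: d(T^nx,T^ny)<\varepsilon\}$ has upper density one, that is, $\limsup_{n\to\infty}\frac{\#(F\cap[0,n-1])}{n}=1$. -/

import Mathlib

open MeasureTheory Filter Topology

namespace DynSys

section Density

/-- The upper density `limsup_{n → ∞} #(F ∩ [0, n - 1]) / n` of a set of non-negative integers. -/
noncomputable def upperDensity (F : Set ℕ) : ℝ :=
  limsup (fun n : ℕ => ((F ∩ Set.Iio n).ncard : ℝ) / (n : ℝ)) atTop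

/-- `F` has Banach density one: for every `c < 1` there is `N ≥ 1` such that `#(F ∩ I) ≥ c * #I`
for every interval `I = {a, …, a + m - 1}` of non-negative integers with `m ≥ N` elements. -/
def HasBanachDensityOne (F : Set ℕ) : Prop :=
  ∀ c : ℝ, c < 1 → ∃ N : ℕ, 1 ≤ N ∧ ∀ a m : ℕ, N ≤ m →
    c * (m : ℝ) ≤ ((F ∩ Set.Ico a (a + m)).ncard : ℝ)

end Density

section Proximality

variable {Y : Type*} [PseudoMetricSpace Y]

/-- The set of times `n ≥ 0` with `d(Tⁿ x, Tⁿ y) < ε`. -/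
def closeTimes (T : C(Y, Y)) (x y : Y) (ε : ℝ) : Set ℕ :=
  {n : ℕ | dist (T^[n] x) (T^[n] y) < ε}

/-- A pair `(x, y)` is proximal if `liminf d(Tⁿ x, Tⁿ y) = 0`. -/
def IsProximalPair (T : C(Y, Y)) (x y : Y) : Prop :=
  liminf (fun n : ℕ => dist (T^[n] x) (T^[n] y)) atTop = 0

/-- A system is proximal if every pair of points is proximal. -/
def IsProximal (T : C(Y, Y)) : Prop :=
  ∀ x y : Y, IsProximalPair T x y

/-- A pair `(x, y)` is Banach proximal if for every `ε > 0` the set of times `n` with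
`d(Tⁿ x, Tⁿ y) < ε` has Banach density one. -/
def IsBanachProximalPair (T : C(Y, Y)) (x y : Y) : Prop :=
  ∀ ε : ℝ, 0 < ε → HasBanachDensityOne (closeTimes T x y ε)

/-- The Banach proximal relation `BP(X, T)`, as a subset of `X²`. -/
def banachProximalRel (T : C(Y, Y)) : Set (Y × Y) :=
  {p | IsBanachProximalPair T p.1 p.2}

end Proximality

section Measures

variable {X : Type*} [MetricSpace X] [MeasurableSpace X] [BorelSpace X]

/-- The map `T_M` on the space `M(X)` of Borel probability measures, `μ ↦ μ ∘ T⁻¹`, which is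
continuous for the weak-* topology. -/
noncomputable def measureMap (T : C(X, X)) : C(ProbabilityMeasure X, ProbabilityMeasure X) where
  toFun μ := μ.map T.continuous.measurable.aemeasurable
  continuous_toFun := ProbabilityMeasure.continuous_map T.continuous

/-- The set `M(X, T)` of `T`-invariant Borel probability measures. -/
def invariantMeasures (T : C(X, X)) : Set (ProbabilityMeasure X) :=
  {μ | measureMap T μ = μ}

/-- A system is uniquely ergodic if `M(X, T)` is a singleton. -/
def IsUniquelyErgodic (T : C(X, X)) : Prop :=
  ∃ μ : ProbabilityMeasure X, invariantMeasures T = {μ}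

/-- The support of the system: the smallest closed set `C` with `μ(C) = 1` for every `μ ∈ M(X, T)`
(see `isLeast_systemSupport`). -/
def systemSupport (T : C(X, X)) : Set X :=
  ⋂₀ {C : Set X | IsClosed C ∧ ∀ μ ∈ invariantMeasures T, (μ : Measure X) C = 1}

/-- On a compact metric space the intersection defining `systemSupport` is itself a closed set of
full measure for every invariant measure. -/
theorem isLeast_systemSupport [CompactSpace X] (T : C(X, X)) :
    IsLeast {C : Set X | IsClosed C ∧ ∀ μ ∈ invariantMeasures T, (μ : Measure X) C = 1}
      (systemSupport T) := by
  refine ⟨⟨isClosed_sInter fun C hC => hC.1, fun μ hμ => ?_⟩, fun C hC => Set.sInter_subset_of_mem hC⟩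
  have hcl : IsClosed (systemSupport T) := isClosed_sInter fun C hC => hC.1
  rw [← prob_compl_eq_zero_iff hcl.measurableSet, systemSupport, Set.compl_sInter]
  obtain ⟨S, hSc, hSsub, hSeq⟩ := TopologicalSpace.isOpen_sUnion_countable
    (compl '' {C : Set X | IsClosed C ∧ ∀ μ ∈ invariantMeasures T, (μ : Measure X) C = 1})
    (by rintro _ ⟨C, hC, rfl⟩; exact hC.1.isOpen_compl)
  rw [← hSeq, measure_sUnion_null_iff hSc]
  intro s hs
  obtain ⟨C, hC, rfl⟩ := hSsub hs
  exact (prob_compl_eq_zero_iff hC.1.measurableSet).2 (hC.2 μ hμ)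

variable [CompactSpace X]

/-- The system `(M(X), T_M)` with `M(X)` metrized by the Lévy-Prokhorov metric, which induces the
weak-* topology; Mathlib puts this metric on the type synonym `LevyProkhorov`. -/
noncomputable def metricMeasureMap (T : C(X, X)) :
    C(LevyProkhorov (ProbabilityMeasure X), LevyProkhorov (ProbabilityMeasure X)) where
  toFun μ := LevyProkhorov.ofMeasure (measureMap T μ.toMeasure)
  continuous_toFun := LevyProkhorov.continuous_ofMeasure_probabilityMeasure.comp
    ((measureMap T).continuous.comp LevyProkhorov.continuous_toMeasure_probabilityMeasure)

/-- A system `(X, T)` is strongly proximal if the induced system `(M(X), T_M)` is proximal. As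
`M(X)` is compact, the choice of a metric inducing its topology does not matter
(see `isProximal_iff_of_homeomorph`). -/
def IsStronglyProximal (T : C(X, X)) : Prop :=
  IsProximal (metricMeasureMap T)

end Measures

section MetricIndependence

variable {Y Z : Type*} [PseudoMetricSpace Y] [PseudoMetricSpace Z]

theorem isProximalPair_iff_frequently [CompactSpace Y] (T : C(Y, Y)) (x y : Y) :
    IsProximalPair T x y ↔ ∀ ε : ℝ, 0 < ε → ∃ᶠ n : ℕ in atTop, dist (T^[n] x) (T^[n] y) < ε := by
  obtain ⟨M, hM⟩ := Metric.isBounded_iff.1 (isCompact_univ (X := Y)).isBounded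
  have hco : IsCoboundedUnder (· ≥ ·) atTop fun n : ℕ => dist (T^[n] x) (T^[n] y) :=
    (isBoundedUnder_of ⟨M, fun n => hM (Set.mem_univ _) (Set.mem_univ _)⟩ :
      IsBoundedUnder (· ≤ ·) atTop fun n : ℕ => dist (T^[n] x) (T^[n] y)).isCoboundedUnder_ge
  have hbd : IsBoundedUnder (· ≥ ·) atTop fun n : ℕ => dist (T^[n] x) (T^[n] y) :=
    isBoundedUnder_of ⟨0, fun n => dist_nonneg⟩
  constructor
  · intro h ε hε
    exact frequently_lt_of_liminf_lt hco (by rw [h]; exact hε)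
  · intro h
    refine le_antisymm (le_of_forall_pos_le_add fun ε hε => ?_)
      (le_liminf_of_le hco (Eventually.of_forall fun n => dist_nonneg))
    rw [zero_add]
    exact liminf_le_of_frequently_le ((h ε hε).mono fun n hn => hn.le) hbd

theorem IsProximal.of_homeomorph [CompactSpace Y] [CompactSpace Z] (e : Y ≃ₜ Z)
    (T : C(Y, Y)) (S : C(Z, Z)) (h : ∀ y, e (T y) = S (e y)) (hT : IsProximal T) :
    IsProximal S := by
  intro u v
  rw [isProximalPair_iff_frequently]
  intro ε hε
  obtain ⟨δ, hδ, hd⟩ := Metric.uniformContinuous_iff.1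
    (CompactSpace.uniformContinuous_of_continuous e.continuous) ε hε
  have hit : ∀ n a, e (T^[n] a) = S^[n] (e a) := fun n =>
    Function.Semiconj.iterate_right (f := e) h n
  refine ((isProximalPair_iff_frequently T _ _).1 (hT (e.symm u) (e.symm v)) δ hδ).mono
    fun n hn => ?_
  simpa [hit] using hd hn

/-- For compact spaces proximality does not depend on the metric inducing the topology. -/
theorem isProximal_iff_of_homeomorph [CompactSpace Y] [CompactSpace Z] (e : Y ≃ₜ Z)
    (T : C(Y, Y)) (S : C(Z, Z)) (h : ∀ y, e (T y) = S (e y)) : IsProximal T ↔ IsProximal S :=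
  ⟨.of_homeomorph e T S h, .of_homeomorph e.symm S T fun z => by
    rw [e.symm_apply_eq, h, e.apply_symm_apply]⟩

end MetricIndependence

end DynSys

open scoped BoundedContinuousFunction

namespace DynSys

/-! ### Counting visits and densities -/

section Density

/-! All five conditions say that the only invariant measure is `δ_z` at a fixed point `z`; the hub
is condition 3. From 3, weak-* limits of empirical measures are invariant, hence equal to `δ_z`,
whatever the starting points. So averages of `d(·, z)` along orbits tend to `0` uniformly
(`exists_forall_birkhoffSum_le`). Applied to two orbits this gives 4, which contains 5; integrated
against two measures it gives 1, since a small mean distance to `z` bounds the Lévy–Prokhorov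
distance to `δ_z`. From 5, orbits nearly return in one step, so a fixed point `z` exists. Pairing
with `z`, every orbit visits each ball about `z` with upper density one. Compactness makes this
uniform (`exists_forall_le_birkhoffSum_indicator`), and integration gives the ball full measure. For
1 to 2, Dirac measures embed `X` in `M(X)`, and invariant measures are fixed points of a proximal
map. For 2 to 3, proximality yields a fixed point, whose Dirac measure is the unique invariant one.
-/

theorem ncard_inter_Ico (F : Set ℕ) (a m : ℕ) :
    ((F ∩ Set.Ico a (a + m)).ncard : ℝ) = ∑ i ∈ Finset.range m, F.indicator 1 (a + i) := by
  classical
  have h : F ∩ Set.Ico a (a + m) =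
      (((Finset.range m).filter (fun i => a + i ∈ F)).map (addLeftEmbedding a) : Finset ℕ) := by
    ext n
    simp only [Set.mem_inter_iff, Set.mem_Ico, Finset.coe_map, Finset.coe_filter,
      Finset.mem_range, addLeftEmbedding_apply, Set.mem_image, Set.mem_ofPred_eq]
    constructor
    · rintro ⟨hF, h1, h2⟩
      exact ⟨n - a, ⟨by omega, by rwa [Nat.add_sub_cancel' h1]⟩, by omega⟩
    · rintro ⟨i, ⟨h1, h2⟩, rfl⟩
      exact ⟨h2, by omega, by omega⟩
  rw [h, Set.ncard_coe_finset, Finset.card_map, Finset.card_filter]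
  push_cast
  exact Finset.sum_congr rfl fun i _ => by simp [Set.indicator_apply]

theorem ncard_inter_Iio (F : Set ℕ) (m : ℕ) :
    ((F ∩ Set.Iio m).ncard : ℝ) = ∑ i ∈ Finset.range m, F.indicator 1 i := by
  have h : Set.Iio m = Set.Ico 0 (0 + m) := by ext; simp
  rw [h, ncard_inter_Ico]
  simp

theorem ncard_inter_Iio_div_le_one (F : Set ℕ) (n : ℕ) :
    ((F ∩ Set.Iio n).ncard : ℝ) / (n : ℝ) ≤ 1 := by
  refine div_le_one_of_le₀ ?_ n.cast_nonneg
  have h := Set.ncard_le_ncard (Set.inter_subset_right : F ∩ Set.Iio n ⊆ Set.Iio n)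
    (Set.finite_Iio n)
  have h' : (Set.Iio n).ncard = n := by
    rw [← Finset.coe_range, Set.ncard_coe_finset, Finset.card_range]
  exact_mod_cast h.trans h'.le

theorem HasBanachDensityOne.upperDensity_eq_one {F : Set ℕ} (hF : HasBanachDensityOne F) :
    upperDensity F = 1 := by
  refine Tendsto.limsup_eq (tendsto_order.2 ⟨fun c hc => ?_, fun c hc =>
    Eventually.of_forall fun n => (ncard_inter_Iio_div_le_one F n).trans_lt hc⟩)
  obtain ⟨b, hcb, hb⟩ := exists_between hc
  obtain ⟨N, hN, h⟩ := hF b hb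
  filter_upwards [eventually_ge_atTop N] with n hn
  have hn0 : (0 : ℝ) < n := by exact_mod_cast (by omega : 0 < n)
  have h1 := h 0 n hn
  have h2 : Set.Ico 0 (0 + n) = Set.Iio n := by ext; simp
  rw [h2] at h1
  exact hcb.trans_le ((le_div_iff₀ hn0).2 h1)

theorem exists_lt_ncard_of_upperDensity_eq_one {F : Set ℕ} (hF : upperDensity F = 1) {c : ℝ}
    (hc : c < 1) : ∃ n : ℕ, 1 ≤ n ∧ c * n < ((F ∩ Set.Iio n).ncard : ℝ) := by
  have hco : IsCoboundedUnder (· ≤ ·) atTop fun n : ℕ => ((F ∩ Set.Iio n).ncard : ℝ) / (n : ℝ) :=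
    (isBoundedUnder_of ⟨0, fun n => by positivity⟩ :
      IsBoundedUnder (· ≥ ·) atTop
        fun n : ℕ => ((F ∩ Set.Iio n).ncard : ℝ) / (n : ℝ)).isCoboundedUnder_le
  have hfr := frequently_lt_of_lt_limsup hco (show c < _ from hc.trans_eq hF.symm)
  obtain ⟨n, hn, hn1⟩ := (hfr.and_eventually (eventually_ge_atTop 1)).exists
  exact ⟨n, hn1, (lt_div_iff₀ (by exact_mod_cast hn1)).1 hn⟩

end Density

/-! ### Fixed points and uniform visit frequencies -/

section Topological

variable {X : Type*} [MetricSpace X] [CompactSpace X]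

theorem exists_fixedPoint_of_forall_exists_dist_lt [Nonempty X] (T : C(X, X))
    (h : ∀ ε : ℝ, 0 < ε → ∃ y, dist y (T y) < ε) : ∃ z, T z = z := by
  obtain ⟨z, -, hz⟩ := isCompact_univ.exists_isMinOn (Set.univ_nonempty (α := X))
    (continuous_id.dist T.continuous).continuousOn
  refine ⟨z, by_contra fun hne => ?_⟩
  obtain ⟨y, hy⟩ := h (dist z (T z)) (dist_pos.2 (Ne.symm hne))
  exact hy.not_ge (hz (Set.mem_univ y))

theorem IsProximal.exists_fixedPoint [Nonempty X] {T : C(X, X)} (hT : IsProximal T) :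
    ∃ z, T z = z := by
  refine exists_fixedPoint_of_forall_exists_dist_lt T fun ε hε => ?_
  obtain ⟨x⟩ := ‹Nonempty X›
  obtain ⟨n, hn⟩ := ((isProximalPair_iff_frequently T x (T x)).1 (hT x (T x)) ε hε).exists
  exact ⟨T^[n] x, by rwa [← Function.iterate_succ_apply' T n x, Function.iterate_succ_apply]⟩

/-- If every orbit visits the open set `U` with frequency above `c` over some initial segment, then
it does so with frequency at least `c` over every segment, up to a uniform additive error. -/
theorem exists_forall_le_birkhoffSum_indicator (T : C(X, X)) {U : Set X} (hU : IsOpen U) {c : ℝ}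
    (hc : 0 ≤ c)
    (h : ∀ x, ∃ n : ℕ, 1 ≤ n ∧ c * n < birkhoffSum T (U.indicator (1 : X → ℝ)) n x) :
    ∃ N : ℕ, ∀ (m : ℕ) (x : X), c * (m - N : ℝ) ≤ birkhoffSum T (U.indicator (1 : X → ℝ)) m x := by
  set g : X → ℝ := U.indicator 1
  have hlsc : ∀ n, LowerSemicontinuous (birkhoffSum T g n) := fun n => by
    refine lowerSemicontinuous_sum fun i _ => ?_
    exact (hU.lowerSemicontinuous_indicator zero_le_one).comp (T.continuous.iterate i)
  have hopen : ∀ n : ℕ, IsOpen {x | c * n < birkhoffSum T g n x} := fun n =>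
    (hlsc n).isOpen_preimage _
  obtain ⟨t, ht⟩ := isCompact_univ.elim_finite_subcover
    (fun n : {n : ℕ // 1 ≤ n} => {x | c * (n : ℕ) < birkhoffSum T g n x}) (fun n => hopen n)
    (fun x _ => by
      obtain ⟨n, hn, hx⟩ := h x
      exact Set.mem_iUnion.2 ⟨⟨n, hn⟩, hx⟩)
  -- `N` is the longest block length in the finite subcover. Strong induction strips off good blocks
  -- until at most `N` steps remain, where the claimed bound is nonpositive.
  refine ⟨t.sup Subtype.val, fun m => ?_⟩
  set N := t.sup Subtype.val
  induction m using Nat.strong_induction_on with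
  | _ m ih =>
    intro x
    rcases le_or_gt m N with hm | hm
    · have h1 : (m : ℝ) ≤ N := by exact_mod_cast hm
      have h2 : 0 ≤ birkhoffSum T g m x :=
        Finset.sum_nonneg fun i _ => Set.indicator_nonneg (fun _ _ => zero_le_one) _
      nlinarith
    · obtain ⟨n, hnt, hn⟩ := Set.mem_iUnion₂.1 (ht (Set.mem_univ x))
      have hnN : (n : ℕ) ≤ N := Finset.le_sup (f := Subtype.val) hnt
      have hn1 := n.2
      have h1 := ih (m - n) (by omega) (T^[n] x)
      have h2 := birkhoffSum_add T g n (m - n) x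
      rw [Nat.add_sub_cancel' (hnN.trans hm.le)] at h2
      rw [Nat.cast_sub (hnN.trans hm.le)] at h1
      have h3 : c * (n : ℕ) < birkhoffSum T g n x := hn
      rw [h2]
      linarith

/-- The distance to a point, as a bounded continuous function on a compact space. -/
noncomputable def distTo (z : X) : X →ᵇ ℝ :=
  BoundedContinuousFunction.mkOfCompact ⟨fun x => dist x z, by fun_prop⟩

@[simp] theorem distTo_apply (z x : X) : distTo z x = dist x z := rfl

end Topological

/-! ### Invariant and empirical measures -/

section Measures

variable {X : Type*} [MetricSpace X] [MeasurableSpace X] [BorelSpace X]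

theorem coe_measureMap (T : C(X, X)) (μ : ProbabilityMeasure X) :
    (measureMap T μ : Measure X) = (μ : Measure X).map T := rfl

theorem measurePreserving_of_mem_invariantMeasures {T : C(X, X)} {μ : ProbabilityMeasure X}
    (hμ : μ ∈ invariantMeasures T) : MeasurePreserving T (μ : Measure X) μ :=
  ⟨T.continuous.measurable, congrArg (fun ν : ProbabilityMeasure X => (ν : Measure X)) hμ⟩

theorem coe_measureMap_iterate (T : C(X, X)) (n : ℕ) (μ : ProbabilityMeasure X) :
    ((measureMap T)^[n] μ : Measure X) = (μ : Measure X).map T^[n] := by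
  induction n with
  | zero => simp
  | succ n ih =>
    rw [Function.iterate_succ_apply', coe_measureMap, ih,
      Measure.map_map T.continuous.measurable (T.continuous.iterate n).measurable,
      Function.iterate_succ']

theorem measureMap_diracProba (T : C(X, X)) (x : X) :
    measureMap T (diracProba x) = diracProba (T x) := by
  apply Subtype.ext
  exact Measure.map_dirac' T.continuous.measurable x

theorem measureMap_iterate_diracProba (T : C(X, X)) (n : ℕ) (x : X) :
    (measureMap T)^[n] (diracProba x) = diracProba (T^[n] x) :=
  (Function.Semiconj.iterate_right (f := diracProba) (ga := T)
    (fun x => (measureMap_diracProba T x).symm) n x).symm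

theorem diracProba_mem_invariantMeasures {T : C(X, X)} {z : X} (hz : T z = z) :
    diracProba z ∈ invariantMeasures T := by
  change measureMap T (diracProba z) = diracProba z
  rw [measureMap_diracProba, hz]

theorem mem_invariantMeasures_of_forall_integral {T : C(X, X)} {μ : ProbabilityMeasure X}
    (h : ∀ f : X →ᵇ ℝ, ∫ x, f (T x) ∂(μ : Measure X) = ∫ x, f x ∂(μ : Measure X)) :
    μ ∈ invariantMeasures T := by
  apply Subtype.ext
  change (μ : Measure X).map T = μ
  have := Measure.isProbabilityMeasure_map (μ := (μ : Measure X)) T.continuous.aemeasurable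
  refine ext_of_forall_integral_eq_of_IsFiniteMeasure fun f => ?_
  rw [← h f]
  exact integral_map T.continuous.aemeasurable f.continuous.aestronglyMeasurable

theorem systemSupport_eq_singleton {T : C(X, X)} {z : X} (hz : T z = z)
    (h : ∀ μ ∈ invariantMeasures T, (μ : Measure X) {z} = 1) : systemSupport T = {z} := by
  refine Set.Subset.antisymm (Set.sInter_subset_of_mem ⟨isClosed_singleton, h⟩) ?_
  rintro _ rfl C ⟨-, hC⟩
  have h1 := hC _ (diracProba_mem_invariantMeasures hz)
  by_contra hzC
  simp [hzC] at h1

theorem measure_singleton_eq_one_of_systemSupport_eq [CompactSpace X] {T : C(X, X)} {z : X}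
    (hs : systemSupport T = {z}) {μ : ProbabilityMeasure X} (hμ : μ ∈ invariantMeasures T) :
    (μ : Measure X) {z} = 1 :=
  hs ▸ (isLeast_systemSupport T).1.2 μ hμ

/-- The empirical measure of the orbit segment `x, T x, …, Tᵐ x`. -/
noncomputable def empiricalMeasure (T : C(X, X)) (m : ℕ) (x : X) : ProbabilityMeasure X :=
  ⟨((m + 1 : ℕ) : ENNReal)⁻¹ • ∑ i ∈ Finset.range (m + 1), Measure.dirac (T^[i] x), ⟨by
    simp only [Measure.smul_apply, Measure.finsetSum_apply, measure_univ, Finset.sum_const,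
      Finset.card_range, smul_eq_mul, nsmul_eq_mul, mul_one]
    exact ENNReal.inv_mul_cancel (by simp) (ENNReal.natCast_ne_top _)⟩⟩

theorem integral_empiricalMeasure (T : C(X, X)) (m : ℕ) (x : X) (f : X →ᵇ ℝ) :
    ∫ y, f y ∂(empiricalMeasure T m x : Measure X) = birkhoffAverage ℝ T f (m + 1) x := by
  change ∫ y, f y ∂(((m + 1 : ℕ) : ENNReal)⁻¹ •
    ∑ i ∈ Finset.range (m + 1), Measure.dirac (T^[i] x)) = _
  rw [integral_smul_measure, integral_finsetSum_measure fun i _ => f.integrable _]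
  simp only [integral_dirac, birkhoffAverage, birkhoffSum, ENNReal.toReal_inv,
    ENNReal.toReal_natCast]

/-- A weak-* limit of empirical measures along longer and longer orbit segments is invariant. -/
theorem mem_invariantMeasures_of_tendsto_empiricalMeasure {T : C(X, X)} {ι : Type*} {l : Filter ι}
    [l.NeBot] {m : ι → ℕ} (hm : Tendsto m l atTop) {x : ι → X} {μ : ProbabilityMeasure X}
    (h : Tendsto (fun k => empiricalMeasure T (m k) (x k)) l (𝓝 μ)) :
    μ ∈ invariantMeasures T := by
  rw [ProbabilityMeasure.tendsto_iff_forall_integral_tendsto] at h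
  refine mem_invariantMeasures_of_forall_integral fun f => ?_
  have h1 := h f
  have h2 := h (f.compContinuous T)
  simp only [integral_empiricalMeasure] at h1 h2
  -- The two averages telescope: only the end terms survive, of size at most `2‖f‖ / (m k + 1)`.
  have h3 : Tendsto (fun k => birkhoffAverage ℝ T (f.compContinuous T) (m k + 1) (x k) -
      birkhoffAverage ℝ T f (m k + 1) (x k)) l (𝓝 0) := by
    have hbd : Tendsto (fun k => 2 * ‖f‖ / ((m k : ℝ) + 1)) l (𝓝 0) :=
      (tendsto_const_nhds.div_atTop (tendsto_atTop_add_const_right _ _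
        tendsto_natCast_atTop_atTop)).comp hm
    refine squeeze_zero_norm (fun k => ?_) hbd
    have he : birkhoffAverage ℝ T (f.compContinuous T) (m k + 1) (x k) =
        birkhoffAverage ℝ T f (m k + 1) (T (x k)) := by
      simp only [birkhoffAverage, birkhoffSum, BoundedContinuousFunction.compContinuous_apply,
        ← Function.iterate_succ_apply', Function.iterate_succ_apply]
    rw [he, birkhoffAverage_apply_sub_birkhoffAverage, norm_smul, norm_inv, div_eq_inv_mul]
    have hn : ‖((m k + 1 : ℕ) : ℝ)‖ = (m k : ℝ) + 1 := by
      rw [Real.norm_natCast]; push_cast; rfl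
    rw [hn]
    gcongr
    calc ‖f (T^[m k + 1] (x k)) - f (x k)‖ ≤ _ := norm_sub_le _ _
      _ ≤ 2 * ‖f‖ := by
        linarith [f.norm_coe_le_norm (T^[m k + 1] (x k)), f.norm_coe_le_norm (x k)]
  exact sub_eq_zero.1 (tendsto_nhds_unique (h2.sub h1) h3)

variable [CompactSpace X]

instance instCompactSpaceLevyProkhorov : CompactSpace (LevyProkhorov (ProbabilityMeasure X)) :=
  LevyProkhorov.probabilityMeasureHomeomorph.compactSpace

/-! ### From the support to Banach proximality -/

/-- If every invariant measure is concentrated at `z`, the Birkhoff sums of a function vanishing at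
`z` are uniformly sublinear. -/
theorem exists_forall_birkhoffSum_le {T : C(X, X)} {z : X}
    (h : ∀ μ ∈ invariantMeasures T, (μ : Measure X) {z} = 1) (f : X →ᵇ ℝ) (hf : f z = 0) {η : ℝ}
    (hη : 0 < η) : ∃ N : ℕ, ∀ m, N ≤ m → ∀ x, birkhoffSum T f m x ≤ η * m := by
  by_contra! hcon
  choose m hm x hx using fun k : ℕ => hcon (k + 1)
  -- An ultrafilter replaces passing to a subsequence. The index `m k - 1` below is used because
  -- `empiricalMeasure T m` averages `m + 1` points.
  set U : Ultrafilter ℕ := Ultrafilter.of atTop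
  have hU : (U : Filter ℕ) ≤ atTop := Ultrafilter.of_le atTop
  obtain ⟨μ, -, hμ⟩ := isCompact_univ.ultrafilter_le_nhds
    (U.map fun k => empiricalMeasure T (m k - 1) (x k)) (by simp)
  have hlim : Tendsto (fun k => empiricalMeasure T (m k - 1) (x k)) U (𝓝 μ) := hμ
  have hmt : Tendsto (fun k => m k - 1) U atTop :=
    (tendsto_atTop_mono (fun k => by have := hm k; change k ≤ m k - 1; omega)
      tendsto_id).mono_left hU
  have hinv := mem_invariantMeasures_of_tendsto_empiricalMeasure hmt hlim
  have h0 : ∫ y, f y ∂(μ : Measure X) = 0 := by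
    have hae : ∀ᵐ y ∂(μ : Measure X), y ∈ ({z} : Set X) :=
      (mem_ae_iff_prob_eq_one (measurableSet_singleton z)).2 (h μ hinv)
    refine integral_eq_zero_of_ae (hae.mono fun y hy => ?_)
    rw [Set.mem_singleton_iff.1 hy]
    exact hf
  have h1 := ProbabilityMeasure.tendsto_iff_forall_integral_tendsto.1 hlim f
  rw [h0] at h1
  refine hη.not_ge (ge_of_tendsto h1 (Eventually.of_forall fun k => ?_))
  have hk := hm k
  rw [integral_empiricalMeasure, show m k - 1 + 1 = m k by omega, birkhoffAverage, smul_eq_mul,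
    ← div_eq_inv_mul, le_div_iff₀ (by exact_mod_cast (by omega : 0 < m k))]
  exact (hx k).le

theorem isBanachProximalPair_of_invariantMeasures {T : C(X, X)} {z : X}
    (h : ∀ μ ∈ invariantMeasures T, (μ : Measure X) {z} = 1) (x y : X) :
    IsBanachProximalPair T x y := by
  intro ε hε c hc
  -- Two orbits together cost at most `2ηm = (1 - c)εm`, leaving `cεm`.
  have hη : 0 < (1 - c) * ε / 2 := by have := sub_pos.2 hc; positivity
  obtain ⟨N, hN⟩ := exists_forall_birkhoffSum_le h (distTo z) (dist_self z) hη
  refine ⟨N + 1, by omega, fun a m hm => ?_⟩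
  have hx := hN m (by omega) (T^[a] x)
  have hy := hN m (by omega) (T^[a] y)
  -- Termwise: at a time outside `closeTimes`, the two distances to `z` add up to at least `ε`.
  have hsum : (m : ℝ) * ε - (birkhoffSum T (distTo z) m (T^[a] x) +
      birkhoffSum T (distTo z) m (T^[a] y)) ≤
      ε * ((closeTimes T x y ε ∩ Set.Ico a (a + m)).ncard : ℝ) := by
    rw [ncard_inter_Ico, birkhoffSum, birkhoffSum, ← Finset.sum_add_distrib, Finset.mul_sum,
      ← nsmul_eq_mul, ← Finset.card_range m, ← Finset.sum_const, Finset.card_range,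
      ← Finset.sum_sub_distrib]
    refine Finset.sum_le_sum fun i _ => ?_
    rw [← Function.iterate_add_apply, ← Function.iterate_add_apply, add_comm i a, distTo_apply,
      distTo_apply]
    have h1 := dist_triangle_right (T^[a + i] x) (T^[a + i] y) z
    have h2 := dist_nonneg (x := T^[a + i] x) (y := z)
    have h3 := dist_nonneg (x := T^[a + i] y) (y := z)
    by_cases hmem : a + i ∈ closeTimes T x y ε
    · simp only [Set.indicator_of_mem hmem, Pi.one_apply]
      linarith
    · simp only [Set.indicator_of_notMem hmem]
      have h4 := not_lt.1 (show ¬ dist (T^[a + i] x) (T^[a + i] y) < ε from hmem)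
      linarith
  refine le_of_mul_le_mul_left ?_ hε
  linarith

/-! ### From upper density to the support -/

/-- Integrating the uniform visit bound against `μ` gives `c(m - N) ≤ m μ(U)`; large `m` forces `c ≤
μ(U)` for every `c < 1`. -/
theorem measure_eq_one_of_forall_upperDensity {T : C(X, X)} {U : Set X} (hU : IsOpen U)
    (h : ∀ x, upperDensity {n | T^[n] x ∈ U} = 1) {μ : ProbabilityMeasure X}
    (hμ : μ ∈ invariantMeasures T) : (μ : Measure X) U = 1 := by
  have hT := measurePreserving_of_mem_invariantMeasures hμ
  have key : ∀ c : ℝ, 0 ≤ c → c < 1 → c ≤ (μ : Measure X).real U := by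
    intro c hc0 hc
    obtain ⟨N, hN⟩ := exists_forall_le_birkhoffSum_indicator T hU hc0 fun x => by
      obtain ⟨n, hn, hlt⟩ := exists_lt_ncard_of_upperDensity_eq_one (h x) hc
      refine ⟨n, hn, ?_⟩
      rw [ncard_inter_Iio] at hlt
      exact hlt
    have hint : ∀ i, Integrable (fun x => U.indicator (1 : X → ℝ) (T^[i] x)) (μ : Measure X) :=
      fun i => (hT.iterate i).integrable_comp_of_integrable
        ((integrable_const (1 : ℝ)).indicator hU.measurableSet)
    have hbound : ∀ m : ℕ, c * (m - N : ℝ) ≤ m * (μ : Measure X).real U := by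
      intro m
      have h1 : ∫ x, birkhoffSum T (U.indicator (1 : X → ℝ)) m x ∂(μ : Measure X) =
          m * (μ : Measure X).real U := by
        simp only [birkhoffSum]
        rw [integral_finsetSum _ fun i _ => hint i]
        have h2 : ∀ i, ∫ x, U.indicator (1 : X → ℝ) (T^[i] x) ∂(μ : Measure X) =
            (μ : Measure X).real U := fun i => by
          rw [← integral_indicator_one hU.measurableSet]
          conv_rhs => rw [← (hT.iterate i).map_eq]
          exact (integral_map (hT.iterate i).aemeasurable
            ((stronglyMeasurable_one.indicator hU.measurableSet).aestronglyMeasurable)).symm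
        simp [h2]
      rw [← h1]
      have h3 := integral_mono (μ := (μ : Measure X)) (integrable_const (c * (m - N : ℝ)))
        (integrable_finsetSum (Finset.range m) fun i _ => hint i) fun x => hN m x
      rwa [integral_const, probReal_univ, one_smul] at h3
    by_contra! hlt
    obtain ⟨m, hm⟩ := exists_nat_gt (c * N / (c - (μ : Measure X).real U))
    rw [div_lt_iff₀ (sub_pos.2 hlt)] at hm
    linarith [hbound m]
  have h1 : (μ : Measure X).real U = 1 := by
    refine le_antisymm measureReal_le_one (le_of_forall_lt_imp_le_of_dense fun c hc => ?_)
    rcases le_or_gt 0 c with h0 | h0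
    · exact key c h0 hc
    · exact h0.le.trans measureReal_nonneg
  rw [measureReal_def] at h1
  rw [← ENNReal.ofReal_toReal (measure_ne_top (μ : Measure X) U), h1, ENNReal.ofReal_one]

theorem measure_singleton_eq_one_of_forall_ball {μ : Measure X} [IsProbabilityMeasure μ] {z : X}
    (h : ∀ ε : ℝ, 0 < ε → μ (Metric.ball z ε) = 1) : μ {z} = 1 := by
  rw [← mem_ae_iff_prob_eq_one (measurableSet_singleton z)]
  have hae : ∀ᵐ x ∂μ, ∀ n : ℕ, x ∈ Metric.ball z (1 / ((n : ℝ) + 1)) :=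
    ae_all_iff.2 fun n =>
      (mem_ae_iff_prob_eq_one measurableSet_ball).2 (h _ Nat.one_div_pos_of_nat)
  filter_upwards [hae] with x hx
  by_contra hne
  obtain ⟨n, hn⟩ := exists_nat_one_div_lt (dist_pos.2 hne)
  exact (hx n).not_gt hn

theorem exists_systemSupport_eq_of_upperDensity [Nonempty X] {T : C(X, X)}
    (h : ∀ x y : X, ∀ ε : ℝ, 0 < ε → upperDensity (closeTimes T x y ε) = 1) :
    ∃ z, systemSupport T = {z} := by
  obtain ⟨z, hz⟩ : ∃ z, T z = z := by
    refine exists_fixedPoint_of_forall_exists_dist_lt T fun ε hε => ?_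
    obtain ⟨x⟩ := ‹Nonempty X›
    -- The constant `0` suffices: one time at which the orbit nearly returns in one step is enough.
    obtain ⟨n, -, hn⟩ := exists_lt_ncard_of_upperDensity_eq_one (h x (T x) ε hε) zero_lt_one
    rw [zero_mul, Nat.cast_pos] at hn
    obtain ⟨k, hk, -⟩ := Set.nonempty_of_ncard_ne_zero hn.ne'
    exact ⟨T^[k] x, by
      rw [← Function.iterate_succ_apply' T k x, Function.iterate_succ_apply]; exact hk⟩
  refine ⟨z, systemSupport_eq_singleton hz fun μ hμ =>
    measure_singleton_eq_one_of_forall_ball fun ε hε =>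
      measure_eq_one_of_forall_upperDensity Metric.isOpen_ball (fun x => ?_) hμ⟩
  have h1 := h x z ε hε
  rw [closeTimes] at h1
  simp only [Function.iterate_fixed hz] at h1
  exact h1

/-! ### Lévy–Prokhorov estimates and strong proximality -/

/-- By Markov, the mass at distance at least `r` from `z` is at most `r`, and a set whose
`ε`-thickening misses `z` lies in that region when `ε > r`. -/
theorem levyProkhorovDist_dirac_le {μ : Measure X} [IsProbabilityMeasure μ] {z : X} {r : ℝ}
    (hr : 0 < r) (h : ∫ x, dist x z ∂μ ≤ r * r) :
    levyProkhorovDist μ (Measure.dirac z) ≤ r := by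
  refine levyProkhorovDist_le_of_forall_le _ _ hr.le fun ε B hε hB => ?_
  by_cases hz : z ∈ Metric.thickening ε B
  · rw [Measure.dirac_apply_of_mem hz]
    exact prob_le_one.trans le_self_add
  · refine le_add_left ?_
    have hsub : B ⊆ {x | r ≤ dist x z} := fun x hx => by
      by_contra hlt
      exact hz (Metric.mem_thickening_iff.2 ⟨x, hx, by
        rw [dist_comm]; exact (not_le.1 hlt).trans hε⟩)
    have hmk := mul_meas_ge_le_integral_of_nonneg (μ := μ) (f := fun x => dist x z)
      (Eventually.of_forall fun x => dist_nonneg) ((distTo z).integrable μ) r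
    have hle : μ.real {x | r ≤ dist x z} ≤ r := le_of_mul_le_mul_left (hmk.trans h) hr
    rw [← ofReal_measureReal]
    exact ENNReal.ofReal_le_ofReal ((measureReal_mono hsub).trans (hle.trans hε.le))

theorem metricMeasureMap_iterate (T : C(X, X)) (n : ℕ) (μ : LevyProkhorov (ProbabilityMeasure X)) :
    (metricMeasureMap T)^[n] μ = LevyProkhorov.ofMeasure ((measureMap T)^[n] μ.toMeasure) := by
  induction n with
  | zero => rfl
  | succ n ih => rw [Function.iterate_succ_apply', ih, Function.iterate_succ_apply']; rfl

theorem integral_dist_measureMap_iterate (T : C(X, X)) (z : X) (n : ℕ)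
    (μ : ProbabilityMeasure X) :
    ∫ x, dist x z ∂((measureMap T)^[n] μ : Measure X) =
      ∫ x, distTo z (T^[n] x) ∂(μ : Measure X) := by
  rw [coe_measureMap_iterate]
  exact integral_map (T.continuous.iterate n).aemeasurable
    (distTo z).continuous.aestronglyMeasurable

theorem isStronglyProximal_of_invariantMeasures {T : C(X, X)} {z : X}
    (h : ∀ μ ∈ invariantMeasures T, (μ : Measure X) {z} = 1) : IsStronglyProximal T := by
  intro μ ν
  rw [isProximalPair_iff_frequently]
  intro ε hε
  set I : ProbabilityMeasure X → ℕ → ℝ := fun ρ n => ∫ x, distTo z (T^[n] x) ∂(ρ : Measure X)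
  have hint : ∀ (ρ : ProbabilityMeasure X) (i : ℕ),
      Integrable (fun x => distTo z (T^[i] x)) (ρ : Measure X) := fun ρ i =>
    ((distTo z).compContinuous ⟨T^[i], T.continuous.iterate i⟩).integrable _
  have hI0 : ∀ ρ n, 0 ≤ I ρ n := fun ρ n => integral_nonneg fun x => dist_nonneg
  have hsum : ∀ ρ : ProbabilityMeasure X, ∀ η : ℝ, 0 < η →
      ∃ N : ℕ, ∀ m, N ≤ m → ∑ i ∈ Finset.range m, I ρ i ≤ η * m := by
    intro ρ η hη
    obtain ⟨N, hN⟩ := exists_forall_birkhoffSum_le h (distTo z) (dist_self z) hη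
    refine ⟨N, fun m hm => ?_⟩
    rw [← integral_finsetSum _ fun i _ => hint ρ i]
    have := integral_mono (μ := (ρ : Measure X))
      (integrable_finsetSum (Finset.range m) fun i _ => hint ρ i)
      (integrable_const (η * m)) fun x => hN m hm x
    simpa using this
  set r := ε / 3
  have hr : 0 < r := by positivity
  have hfreq : ∃ᶠ n in atTop, I μ.toMeasure n + I ν.toMeasure n < r * r := by
    intro hev
    obtain ⟨M, hM⟩ := eventually_atTop.1 hev
    -- If the sum stayed above `r²` from `M` on, the times in `[K, 2K)` would contribute at least
    -- `Kr²`, while both averages over `[0, 2K)` allow only `2 · (r²/8) · 2K = Kr²/2`.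
    have hη : 0 < r * r / 8 := by positivity
    obtain ⟨N₁, hN₁⟩ := hsum μ.toMeasure _ hη
    obtain ⟨N₂, hN₂⟩ := hsum ν.toMeasure _ hη
    set K := max M (max N₁ N₂) + 1
    have h1 := hN₁ (2 * K) (by omega)
    have h2 := hN₂ (2 * K) (by omega)
    have h3 : (K : ℝ) * (r * r) ≤
        ∑ i ∈ Finset.range (2 * K), (I μ.toMeasure i + I ν.toMeasure i) := by
      rw [two_mul, Finset.sum_range_add]
      have ha : 0 ≤ ∑ i ∈ Finset.range K, (I μ.toMeasure i + I ν.toMeasure i) :=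
        Finset.sum_nonneg fun i _ => add_nonneg (hI0 _ _) (hI0 _ _)
      have hb : (K : ℝ) * (r * r) ≤
          ∑ i ∈ Finset.range K, (I μ.toMeasure (K + i) + I ν.toMeasure (K + i)) := by
        have := Finset.card_nsmul_le_sum (Finset.range K)
          (fun i => I μ.toMeasure (K + i) + I ν.toMeasure (K + i)) (r * r)
          fun i _ => not_lt.1 (hM (K + i) (by omega))
        simpa using this
      linarith
    rw [Finset.sum_add_distrib] at h3
    have hK : (0 : ℝ) < K := by positivity
    push_cast at h1 h2
    nlinarith [mul_pos hK (mul_pos hr hr)]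
  refine hfreq.mono fun n hn => ?_
  have hdist : ∀ ρ : LevyProkhorov (ProbabilityMeasure X), I ρ.toMeasure n ≤ r * r →
      dist ((metricMeasureMap T)^[n] ρ) (LevyProkhorov.ofMeasure (diracProba z)) ≤ r := by
    intro ρ hρ
    rw [metricMeasureMap_iterate]
    exact levyProkhorovDist_dirac_le (μ := ((measureMap T)^[n] ρ.toMeasure : Measure X)) hr
      ((integral_dist_measureMap_iterate T z n ρ.toMeasure).trans_le hρ)
  have h1 := hdist μ (by linarith [hI0 ν.toMeasure n])
  have h2 := hdist ν (by linarith [hI0 μ.toMeasure n])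
  have h3 := dist_triangle_right ((metricMeasureMap T)^[n] μ) ((metricMeasureMap T)^[n] ν)
    (LevyProkhorov.ofMeasure (diracProba z))
  have h4 : ε = 3 * r := by simp only [r]; ring
  linarith

/-- Test on the set `{x}`: if `y` is outside its `c`-thickening, the defining inequality reads `1 ≤
c`, impossible for `c < r ≤ 1`. -/
theorem dist_lt_of_levyProkhorovDist_dirac_lt {x y : X} {r : ℝ} (hr : r ≤ 1)
    (h : levyProkhorovDist (Measure.dirac x) (Measure.dirac y) < r) : dist x y < r := by
  have hr0 : 0 < r := ENNReal.toReal_nonneg.trans_lt h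
  have h' : levyProkhorovEDist (Measure.dirac x) (Measure.dirac y) < ENNReal.ofReal r :=
    (ENNReal.lt_ofReal_iff_toReal_lt (levyProkhorovEDist_ne_top _ _)).2 h
  obtain ⟨c, hc, hcr⟩ := sInf_lt_iff.1 h'
  have h1 := (hc {x} (measurableSet_singleton x)).1
  have hct : c ≠ ⊤ := ne_top_of_lt hcr
  have hc1 : c < 1 := hcr.trans_le (by simpa using ENNReal.ofReal_le_ofReal hr)
  have hcr' : c.toReal < r := (ENNReal.lt_ofReal_iff_toReal_lt hct).1 hcr
  by_contra hxy
  have hy : y ∉ Metric.thickening c.toReal {x} := fun hy => by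
    rw [Metric.thickening_singleton, Metric.mem_ball, dist_comm] at hy
    exact hxy (hy.trans hcr')
  rw [Measure.dirac_apply_of_mem (Set.mem_singleton x), Measure.dirac_apply,
    Set.indicator_of_notMem hy, zero_add] at h1
  exact h1.not_gt hc1

theorem IsStronglyProximal.isProximal {T : C(X, X)} (hT : IsStronglyProximal T) :
    IsProximal T := by
  intro x y
  rw [isProximalPair_iff_frequently]
  intro ε hε
  refine ((isProximalPair_iff_frequently _ _ _).1 (hT (.ofMeasure (diracProba x))
    (.ofMeasure (diracProba y))) (min ε 1) (lt_min hε one_pos)).mono fun n hn => ?_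
  rw [metricMeasureMap_iterate, metricMeasureMap_iterate, measureMap_iterate_diracProba,
    measureMap_iterate_diracProba] at hn
  exact (dist_lt_of_levyProkhorovDist_dirac_lt (min_le_right _ _) hn).trans_le (min_le_left _ _)

/-- The distance between two fixed points of the induced map is constant in time, so a zero liminf
makes them equal. -/
theorem IsStronglyProximal.invariantMeasures_subsingleton {T : C(X, X)}
    (hT : IsStronglyProximal T) : (invariantMeasures T).Subsingleton := by
  intro μ hμ ν hν
  have hfix : ∀ ρ ∈ invariantMeasures T, ∀ n,
      (metricMeasureMap T)^[n] (.ofMeasure ρ) = LevyProkhorov.ofMeasure ρ := fun ρ hρ n => by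
    rw [metricMeasureMap_iterate, Function.iterate_fixed hρ]
  have h := hT (.ofMeasure μ) (.ofMeasure ν)
  simp only [IsProximalPair, hfix μ hμ, hfix ν hν, liminf_const] at h
  exact congrArg LevyProkhorov.toMeasure (dist_eq_zero.1 h)

theorem IsStronglyProximal.isUniquelyErgodic [Nonempty X] {T : C(X, X)}
    (hT : IsStronglyProximal T) : IsUniquelyErgodic T := by
  obtain ⟨z, hz⟩ := hT.isProximal.exists_fixedPoint
  exact ⟨diracProba z, hT.invariantMeasures_subsingleton.eq_singleton_of_mem
    (diracProba_mem_invariantMeasures hz)⟩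

theorem exists_systemSupport_eq_of_isProximal [Nonempty X] {T : C(X, X)} (hT : IsProximal T)
    (hu : IsUniquelyErgodic T) : ∃ z, systemSupport T = {z} := by
  obtain ⟨z, hz⟩ := hT.exists_fixedPoint
  obtain ⟨ρ, hρ⟩ := hu
  refine ⟨z, systemSupport_eq_singleton hz fun μ hμ => ?_⟩
  have hd := diracProba_mem_invariantMeasures hz
  rw [hρ, Set.mem_singleton_iff] at hd hμ
  rw [hμ, ← hd]
  simp

end Measures

end DynSys

theorem theorem5p2 {X : Type*} [MetricSpace X] [CompactSpace X] [Nonempty X]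
    [MeasurableSpace X] [BorelSpace X] (T : C(X, X)) :
    List.TFAE [
      DynSys.IsStronglyProximal T,
      DynSys.IsProximal T ∧ DynSys.IsUniquelyErgodic T,
      ∃ z : X, DynSys.systemSupport T = {z},
      DynSys.banachProximalRel T = Set.univ,
      ∀ x y : X, ∀ ε : ℝ, 0 < ε → DynSys.upperDensity (DynSys.closeTimes T x y ε) = 1] := by
  tfae_have 1 → 2 := fun h => ⟨h.isProximal, h.isUniquelyErgodic⟩
  tfae_have 2 → 3 := fun h => DynSys.exists_systemSupport_eq_of_isProximal h.1 h.2
  tfae_have 3 → 4 := fun ⟨z, hz⟩ => Set.eq_univ_of_forall fun p =>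
    DynSys.isBanachProximalPair_of_invariantMeasures
      (fun _ => DynSys.measure_singleton_eq_one_of_systemSupport_eq hz) p.1 p.2
  tfae_have 4 → 5 := fun h x y ε hε =>
    (Set.eq_univ_iff_forall.1 h (x, y) ε hε).upperDensity_eq_one
  tfae_have 5 → 3 := DynSys.exists_systemSupport_eq_of_upperDensity
  tfae_have 3 → 1 := fun ⟨z, hz⟩ => DynSys.isStronglyProximal_of_invariantMeasures
    fun _ => DynSys.measure_singleton_eq_one_of_systemSupport_eq hz
  tfae_finish
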